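/- Corollary (Thickness Formula for Curves in $\mathbb{R}^n$). Let $\gamma$ be a simple closed regular $C^{1,1}$ curve in $\mathbb{R}^n$; that is, for some $L>0$, $\gamma:\mathbb{R}\to\mathbb{R}^n$ is $L$-periodic, injective on $[0,L)$, of class $C^1$ with $\gamma'$ Lipschitz, and $\gamma'(t)\neq 0$ for all $t$. Let $K=\gamma(\mathbb{R})$ and, for $p\in K$, let $N_pK$ be the space of vectors orthogonal to the tangent line of $K$ at $p$. Define, in $[0,\infty]$ (with $\inf\emptyset=\infty$, $0^{-1}=\infty$, $\infty^{-1}=0$): * $i(K)$, the normal injectivity radius (thickness): the supremum of $0$ and of all $r>0$ such that $(p,v)\mapsto p+v$ is one-to-one on $\{(p,v):p\in K,\ v\in N_pK,\ \|v\|<r\}$; * $R_O(K)$, the ball radius: the infimum of all $r>0$ such that, for some $p\in K$ and some unit vector $w\in N_pK$, the open ball of radius $r$ centred at $p+rw$ meets $K$; * $MDC(K)$, the minimal double critical distance: the infimum of $\|p-q\|$ over all pairs of distinct points $p,q\in K$ such that $q-p$ is orthogonal to the tangent lines of $K$ at both $p$ and $q$; * $\sup\kappa_\gamma$: the supremum of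 the curvature $\kappa_\gamma(t)=\|T'(t)\|/\|\gamma'(t)\|$, where $T=\gamma'/\|\gamma'\|$, over all $t$ at which $\gamma''(t)$ exists (almost every $t$, by Rademacher's theorem). Then $$i(K)=R_O(K)=\min\{(\sup\kappa_\gamma)^{-1},\ \tfrac12 MDC(K)\}.$$ -/

import Mathlib

open scoped NNReal ENNReal

noncomputable section

namespace Thickness

variable {E : Type*} [NormedAddCommGroup E] [InnerProductSpace ℝ E]

/-- The tangent space of a `C¹` submanifold `K` of a Euclidean space at `p`, described through the
set `K` only: the span of the limits of rescaled secants of `K` at `p`. -/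
def tangentSpace (K : Set E) (p : E) : Submodule ℝ E :=
  Submodule.span ℝ (tangentConeAt ℝ K p)

/-- The fibre at `p` of the normal bundle of `K`. -/
def normalSpace (K : Set E) (p : E) : Submodule ℝ E :=
  (tangentSpace K p)ᗮ

/-- The open disc bundle of radius `r` in the normal bundle of `K`, as pairs of a
base point and a normal vector. -/
def normalDiscBundle (K : Set E) (r : ℝ) : Set (E × E) :=
  {x | x.1 ∈ K ∧ x.2 ∈ normalSpace K x.1 ∧ ‖x.2‖ < r}

/-- The exponential map of a Euclidean space. -/
def expMap (x : E × E) : E := x.1 + x.2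

/-- The thickness `i(K)`: the injectivity radius of the normal exponential map of `K`. -/
def normalInjectivityRadius (K : Set E) : ℝ≥0∞ :=
  sSup ({0} ∪ ENNReal.ofReal '' {r : ℝ | 0 < r ∧ Set.InjOn expMap (normalDiscBundle K r)})

/-- `O_p(r; K)`: the union of the open balls of radius `r` tangent to `K` at `p`. -/
def tangentBallsAt (K : Set E) (p : E) (r : ℝ) : Set E :=
  ⋃ w ∈ {w : E | w ∈ normalSpace K p ∧ ‖w‖ = 1}, Metric.ball (p + r • w) r

/-- `O(r; K)`: the union of the open balls of radius `r` tangent to `K`. -/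
def tangentBalls (K : Set E) (r : ℝ) : Set E :=
  ⋃ p ∈ K, tangentBallsAt K p r

/-- The (rolling) ball radius `R_O(K)`. -/
def ballRadius (K : Set E) : ℝ≥0∞ :=
  sInf (ENNReal.ofReal '' {r : ℝ | 0 < r ∧ (tangentBalls K r ∩ K).Nonempty})

/-- `p`, `q` form a double critical pair for `K`. The geodesics of positive length of a Euclidean
space are the nondegenerate line segments, and all of them are minimal; the one from `p` to `q`
has to be normal to `K` at both of its endpoints. -/
def IsDoubleCriticalPair (K : Set E) (p q : E) : Prop :=
  p ∈ K ∧ q ∈ K ∧ p ≠ q ∧ q - p ∈ normalSpace K p ∧ q - p ∈ normalSpace K q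

/-- The minimal double critical distance `MDC(K)`. -/
def minDoubleCriticalDist (K : Set E) : ℝ≥0∞ :=
  sInf {d : ℝ≥0∞ | ∃ p q : E, IsDoubleCriticalPair K p q ∧ d = edist p q}

/-- `γ` is a regular parametrization, of period `L`, of a simple closed curve of
class `C^{1,1}`. -/
structure IsSimpleClosedC11Curve (γ : ℝ → E) (L : ℝ) : Prop where
  period_pos : 0 < L
  periodic : Function.Periodic γ L
  simple : Set.InjOn γ (Set.Ico 0 L)
  contDiff : ContDiff ℝ 1 γ
  lipschitz_deriv : ∃ C : ℝ≥0, LipschitzWith C (deriv γ)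
  regular : ∀ t, deriv γ t ≠ 0

/-- The unit tangent vector of a regular curve. -/
def unitTangent (γ : ℝ → E) (t : ℝ) : E := ‖deriv γ t‖⁻¹ • deriv γ t

/-- The curvature of a regular curve at a parameter where its second derivative exists: the norm of
the derivative of the unit tangent vector with respect to arc length. -/
def curvature (γ : ℝ → E) (t : ℝ) : ℝ := ‖deriv (unitTangent γ) t‖ / ‖deriv γ t‖

/-- The supremum of the curvature over the parameters where the second derivative exists. -/
def supCurvature (γ : ℝ → E) : ℝ≥0∞ :=
  ⨆ t ∈ {t : ℝ | DifferentiableAt ℝ (deriv γ) t}, ENNReal.ofReal (curvature γ t)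

end Thickness

end

open scoped NNReal ENNReal

open Set Filter Topology MeasureTheory

noncomputable section

namespace Thickness

variable {E : Type*} [NormedAddCommGroup E] [InnerProductSpace ℝ E]

/-! ### Periodicity, normal spaces and speed of the curve. -/

namespace IsSimpleClosedC11Curve

variable {γ : ℝ → E} {L : ℝ}

/-! Everything is compared with one condition, `MeetsTangentBall γ r`: a point of the curve lies in
an open ball of radius `r` tangent at another point. It persists as `r` grows.

Two normal vectors with a common endpoint put one foot in a tangent ball barely larger than the
longer vector; conversely, the centre of a tangent ball that meets `K` has a second, nearer foot.
Hence `i(K) = R_O(K)`. Double critical pairs and points of large curvature produce such balls, which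
bounds `R_O(K)` above.

For the lower bound, suppose a ball of radius `r` below both quantities meets `K`. As `r * sup κ <
1`, the two parameters stay uniformly apart (`exists_forall_lt_norm_sub_sq`), so compactness gives a
least touching radius `ρ ≤ r` (`exists_minimal_touching`). The two normals at the touching points
are opposite (`eq_neg_of_touching`): otherwise a shift of the centre would give two distinct feet at
distance less than `ρ`. The touching points thus form a double critical pair at distance `2ρ ≤ 2r`,
a contradiction. -/

theorem hasDerivAt (hγ : IsSimpleClosedC11Curve γ L) (t : ℝ) : HasDerivAt γ (deriv γ t) t :=
  (hγ.contDiff.differentiable (by norm_num) t).hasDerivAt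

theorem continuous (hγ : IsSimpleClosedC11Curve γ L) : Continuous γ := hγ.contDiff.continuous

theorem continuous_deriv (hγ : IsSimpleClosedC11Curve γ L) : Continuous (deriv γ) :=
  hγ.contDiff.continuous_deriv (by norm_num)

theorem periodic_deriv (hγ : IsSimpleClosedC11Curve γ L) : Function.Periodic (deriv γ) L := by
  intro t
  rw [← deriv_comp_add_const]
  congr 1
  exact funext hγ.periodic

theorem eq_of_mem_Ico (hγ : IsSimpleClosedC11Curve γ L) {a s t : ℝ} (hs : s ∈ Ico a (a + L))
    (ht : t ∈ Ico a (a + L)) (h : γ s = γ t) : s = t := by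
  have key : ∀ x, γ (toIcoMod hγ.period_pos 0 x) = γ x := fun x => by
    rw [toIcoMod]
    exact hγ.periodic.sub_zsmul_eq _
  have hm : ∀ x, toIcoMod hγ.period_pos 0 x ∈ Ico 0 L := fun x => by
    simpa using toIcoMod_mem_Ico hγ.period_pos 0 x
  have h1 := hγ.simple (hm s) (hm t) (by rw [key, key, h])
  have h2 : toIcoMod hγ.period_pos a s = toIcoMod hγ.period_pos a t := by
    rw [toIcoMod_inj hγ.period_pos] at h1 ⊢
    exact h1
  rwa [(toIcoMod_eq_self hγ.period_pos).2 hs, (toIcoMod_eq_self hγ.period_pos).2 ht] at h2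

theorem isCompact_range (hγ : IsSimpleClosedC11Curve γ L) : IsCompact (range γ) := by
  have : range γ = γ '' Icc 0 L := by
    refine subset_antisymm ?_ (image_subset_range _ _)
    rintro _ ⟨t, rfl⟩
    obtain ⟨s, hs, h⟩ := hγ.periodic.exists_mem_Ico₀ hγ.period_pos t
    exact ⟨s, Ico_subset_Icc_self hs, h.symm⟩
  rw [this]
  exact isCompact_Icc.image hγ.continuous

/-- The part of one period away from `t` has compact image missing `γ t`, so points of the curve
near `γ t` come from parameters near `t`. Local estimates thereby pass from the parameter to the
set. -/
theorem nhdsWithin_range_le (hγ : IsSimpleClosedC11Curve γ L) (t : ℝ) :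
    𝓝[range γ] (γ t) ≤ map γ (𝓝 t) := by
  intro S hS
  obtain ⟨U, hUS, hU, htU⟩ := mem_nhds_iff.1 (mem_map.1 hS)
  have hL := hγ.period_pos
  have hC : IsCompact (γ '' (Icc (t - L / 2) (t + L / 2) \ U)) :=
    (isCompact_Icc.diff hU).image hγ.continuous
  have hne : ∀ s ∈ Icc (t - L / 2) (t + L / 2), γ s = γ t → s = t := by
    intro s hs h
    rcases le_or_gt t s with hts | hts
    · exact hγ.eq_of_mem_Ico (a := t) ⟨hts, by linarith [hs.2]⟩ ⟨le_rfl, by linarith⟩ h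
    · exact hγ.eq_of_mem_Ico (a := s) ⟨le_rfl, by linarith⟩ ⟨hts.le, by linarith [hs.1]⟩ h
  have hmem : (γ '' (Icc (t - L / 2) (t + L / 2) \ U))ᶜ ∈ 𝓝 (γ t) := by
    refine hC.isClosed.isOpen_compl.mem_nhds ?_
    rintro ⟨s, ⟨hs, hsU⟩, h⟩
    exact hsU (hne s hs h ▸ htU)
  filter_upwards [mem_nhdsWithin_of_mem_nhds hmem, self_mem_nhdsWithin]
  rintro _ hx ⟨s', rfl⟩
  obtain ⟨s, hs, h⟩ := hγ.periodic.exists_mem_Ico hL s' (t - L / 2)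
  rw [h] at hx ⊢
  by_contra hcon
  refine hx ⟨s, ⟨⟨hs.1, by linarith [hs.2]⟩, fun hsU => hcon (hUS hsU)⟩, rfl⟩

theorem mem_normalSpace_iff (hγ : IsSimpleClosedC11Curve γ L) {t : ℝ} {w : E} :
    w ∈ normalSpace (range γ) (γ t) ↔ inner ℝ (deriv γ t) w = 0 := by
  constructor
  · intro hw
    refine (Submodule.mem_orthogonal _ _).1 hw _ (Submodule.subset_span ?_)
    have h := (hγ.hasDerivAt t).hasFDerivAt.hasFDerivWithinAt (s := univ)
    have h2 := h.mapsTo_tangent_cone (show (1 : ℝ) ∈ tangentConeAt ℝ univ t by simp)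
    simpa using h2
  · intro hw
    have hlo : (fun s => inner ℝ w (γ s - γ t)) =o[𝓝 t] fun s => γ s - γ t := by
      have h1 : HasDerivAt (fun s => inner ℝ w (γ s)) 0 t := by
        have := (hasDerivAt_const t w).inner ℝ (hγ.hasDerivAt t)
        rw [real_inner_comm] at hw
        simpa [hw] using this
      have h2 : (fun s => inner ℝ w (γ s - γ t)) =o[𝓝 t] fun s => s - t := by
        have := hasDerivAt_iff_isLittleO.1 h1
        simpa [inner_sub_right] using this
      have h3 := ((hγ.hasDerivAt t).isTheta_sub (hγ.regular t)).2
      exact h2.trans_isBigO (h3.comp_tendsto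
        (tendsto_id.prodMk (tendsto_pure.2 (Eventually.of_forall fun _ => rfl))))
    have hlo' : (fun x => inner ℝ w (x - γ t)) =o[𝓝[range γ] (γ t)] fun x => x - γ t :=
      (Asymptotics.isLittleO_map.2 hlo).mono (hγ.nhdsWithin_range_le t)
    have hA : HasFDerivWithinAt (fun x => inner ℝ w x) (innerSL ℝ w) (range γ) (γ t) :=
      (innerSL ℝ w).hasFDerivWithinAt
    have hB : HasFDerivWithinAt (fun x => inner ℝ w x) (0 : E →L[ℝ] ℝ) (range γ) (γ t) := by
      rw [hasFDerivWithinAt_iff_isLittleO]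
      simpa [inner_sub_right] using hlo'
    -- The functional `⟪w, ·⟫` has two derivatives within the curve, itself and `0`; they must agree
    -- on the tangent cone.
    have heq := hA.unique_on hB
    refine (Submodule.mem_orthogonal' _ _).2 fun u hu => ?_
    induction hu using Submodule.span_induction with
    | mem x hx => simpa using heq hx
    | zero => simp
    | add x y _ _ hx hy => simp [inner_add_right, hx, hy]
    | smul a x _ hx => simp [inner_smul_right, hx]

theorem exists_speed_bounds (hγ : IsSimpleClosedC11Curve γ L) :
    ∃ m M : ℝ, 0 < m ∧ ∀ t, m ≤ ‖deriv γ t‖ ∧ ‖deriv γ t‖ ≤ M := by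
  have hne : (Icc 0 L).Nonempty := nonempty_Icc.2 hγ.period_pos.le
  obtain ⟨a, -, ha⟩ := isCompact_Icc.exists_isMinOn hne hγ.continuous_deriv.norm.continuousOn
  obtain ⟨b, -, hb⟩ := isCompact_Icc.exists_isMaxOn hne hγ.continuous_deriv.norm.continuousOn
  refine ⟨‖deriv γ a‖, ‖deriv γ b‖, norm_pos_iff.2 (hγ.regular a), fun t => ?_⟩
  obtain ⟨s, hs, h⟩ := hγ.periodic_deriv.exists_mem_Ico₀ hγ.period_pos t
  rw [h]
  exact ⟨ha (Ico_subset_Icc_self hs), hb (Ico_subset_Icc_self hs)⟩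

theorem norm_unitTangent (hγ : IsSimpleClosedC11Curve γ L) (t : ℝ) : ‖unitTangent γ t‖ = 1 := by
  have := norm_ne_zero_iff.2 (hγ.regular t)
  simp [unitTangent, norm_smul, this]

theorem deriv_eq_norm_smul_unitTangent (hγ : IsSimpleClosedC11Curve γ L) (t : ℝ) :
    deriv γ t = ‖deriv γ t‖ • unitTangent γ t := by
  have := norm_ne_zero_iff.2 (hγ.regular t)
  simp [unitTangent, smul_smul, this]

theorem lipschitz_unitTangent (hγ : IsSimpleClosedC11Curve γ L) :
    ∃ C : ℝ≥0, LipschitzWith C (unitTangent γ) := by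
  obtain ⟨C, hC⟩ := hγ.lipschitz_deriv
  obtain ⟨m, M, hm, hb⟩ := hγ.exists_speed_bounds
  refine ⟨Real.toNNReal (2 / m * C), LipschitzWith.of_dist_le_mul fun s t => ?_⟩
  have hs := norm_pos_iff.2 (hγ.regular s)
  have ht := norm_pos_iff.2 (hγ.regular t)
  -- Both the change of velocity and the change of speed are at most `C * dist s t`, whence the
  -- factor `2 / m`.
  have h1 : unitTangent γ s - unitTangent γ t = ‖deriv γ s‖⁻¹ •
      ((deriv γ s - deriv γ t) + (‖deriv γ t‖ - ‖deriv γ s‖) • unitTangent γ t) := by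
    rw [sub_smul, ← hγ.deriv_eq_norm_smul_unitTangent t, smul_add, smul_sub, smul_sub, smul_smul,
      inv_mul_cancel₀ hs.ne', one_smul]
    simp only [unitTangent]
    abel
  have h2 : ‖deriv γ s - deriv γ t‖ ≤ C * dist s t := by
    rw [← dist_eq_norm]; exact hC.dist_le_mul s t
  have h3 : ‖(‖deriv γ t‖ - ‖deriv γ s‖) • unitTangent γ t‖ ≤ ‖deriv γ s - deriv γ t‖ := by
    rw [norm_smul, hγ.norm_unitTangent, mul_one, norm_sub_rev (deriv γ s)]
    exact abs_norm_sub_norm_le _ _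
  rw [Real.coe_toNNReal _ (by positivity), dist_eq_norm, h1, norm_smul, norm_inv, norm_norm]
  have h4 : ‖deriv γ s‖⁻¹ ≤ m⁻¹ := inv_anti₀ hm (hb s).1
  calc _ ≤ m⁻¹ * (C * dist s t + C * dist s t) := by
        gcongr
        exact (norm_add_le _ _).trans (add_le_add h2 (h3.trans h2))
    _ = _ := by ring

end IsSimpleClosedC11Curve

/-! ### Tangent balls in terms of the parametrization. -/

/-- Some open ball of radius `r` tangent to the image of `γ` meets the image of `γ`. -/
def MeetsTangentBall (γ : ℝ → E) (r : ℝ) : Prop :=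
  ∃ t s w, inner ℝ (deriv γ t) w = 0 ∧ ‖w‖ = 1 ∧
    ‖γ s - γ t‖ ^ 2 < 2 * r * inner ℝ (γ s - γ t) w

theorem norm_sub_add_smul_sq {p w : E} (hw : ‖w‖ = 1) (x : E) (r : ℝ) :
    ‖x - (p + r • w)‖ ^ 2 = ‖x - p‖ ^ 2 - 2 * r * inner ℝ (x - p) w + r ^ 2 := by
  rw [← sub_sub, norm_sub_sq_real, inner_smul_right, norm_smul, hw, mul_one, Real.norm_eq_abs,
    sq_abs]
  ring

theorem mem_ball_add_smul_iff {p w : E} (hw : ‖w‖ = 1) (x : E) {r : ℝ} (hr : 0 < r) :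
    x ∈ Metric.ball (p + r • w) r ↔ ‖x - p‖ ^ 2 < 2 * r * inner ℝ (x - p) w := by
  rw [mem_ball_iff_norm, ← sq_lt_sq₀ (norm_nonneg _) hr.le, norm_sub_add_smul_sq hw]
  constructor <;> intro h <;> linarith

/-- The defining strict inequality is continuous in `r`; this is what will exclude a meeting at the
least touching radius. -/
theorem MeetsTangentBall.exists_lt {γ : ℝ → E} {r : ℝ} (hr : 0 < r) (h : MeetsTangentBall γ r) :
    ∃ r', 0 < r' ∧ r' < r ∧ MeetsTangentBall γ r' := by
  obtain ⟨t, s, w, hw, hw1, hlt⟩ := h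
  have h1 : ∀ᶠ x in 𝓝[<] r, ‖γ s - γ t‖ ^ 2 < 2 * x * inner ℝ (γ s - γ t) w := by
    refine nhdsWithin_le_nhds (ContinuousAt.eventually_lt (by fun_prop) (by fun_prop) hlt)
  have h2 : ∀ᶠ x in 𝓝[<] r, 0 < x := nhdsWithin_le_nhds (lt_mem_nhds hr)
  obtain ⟨x, hx1, hx2, hx3⟩ := (h1.and (h2.and self_mem_nhdsWithin)).exists
  exact ⟨x, hx2, hx3, t, s, w, hw, hw1, hx1⟩

theorem MeetsTangentBall.mono {γ : ℝ → E} {r r' : ℝ} (hr : 0 < r) (hrr' : r ≤ r')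
    (h : MeetsTangentBall γ r) : MeetsTangentBall γ r' := by
  obtain ⟨t, s, w, hw, hw1, hlt⟩ := h
  refine ⟨t, s, w, hw, hw1, hlt.trans_le ?_⟩
  have h1 : 0 < 2 * r * inner ℝ (γ s - γ t) w := (sq_nonneg _).trans_lt hlt
  have h2 : 0 < inner ℝ (γ s - γ t) w := pos_of_mul_pos_right h1 (by positivity)
  gcongr

namespace IsSimpleClosedC11Curve

variable {γ : ℝ → E} {L : ℝ}

theorem tangentBalls_inter_nonempty_iff (hγ : IsSimpleClosedC11Curve γ L) {r : ℝ} (hr : 0 < r) :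
    (tangentBalls (range γ) r ∩ range γ).Nonempty ↔ MeetsTangentBall γ r := by
  constructor
  · rintro ⟨_, hx, s, rfl⟩
    simp only [tangentBalls, tangentBallsAt, mem_iUnion, mem_range, exists_prop,
      mem_ofPred_eq] at hx
    obtain ⟨_, ⟨t, rfl⟩, w, ⟨hw, hw1⟩, hx⟩ := hx
    exact ⟨t, s, w, hγ.mem_normalSpace_iff.1 hw, hw1, (mem_ball_add_smul_iff hw1 _ hr).1 hx⟩
  · rintro ⟨t, s, w, hw, hw1, h⟩
    refine ⟨γ s, ?_, s, rfl⟩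
    simp only [tangentBalls, tangentBallsAt, mem_iUnion, mem_range, exists_prop, mem_ofPred_eq]
    exact ⟨γ t, ⟨t, rfl⟩, w, ⟨hγ.mem_normalSpace_iff.2 hw, hw1⟩,
      (mem_ball_add_smul_iff hw1 _ hr).2 h⟩

theorem ballRadius_le (hγ : IsSimpleClosedC11Curve γ L) {a : ℝ} (ha : 0 ≤ a)
    (h : ∀ r, a < r → MeetsTangentBall γ r) : ballRadius (range γ) ≤ ENNReal.ofReal a := by
  have h1 : ∀ᶠ r in 𝓝[>] a, ballRadius (range γ) ≤ ENNReal.ofReal r := by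
    filter_upwards [self_mem_nhdsWithin] with r hr
    have hr0 : 0 < r := ha.trans_lt hr
    exact sInf_le ⟨r, ⟨hr0, (hγ.tangentBalls_inter_nonempty_iff hr0).2 (h r hr)⟩, rfl⟩
  exact ge_of_tendsto ((ENNReal.continuous_ofReal.tendsto a).mono_left nhdsWithin_le_nhds) h1

theorem le_ballRadius (hγ : IsSimpleClosedC11Curve γ L) {b : ℝ≥0∞}
    (h : ∀ r, 0 < r → MeetsTangentBall γ r → b ≤ ENNReal.ofReal r) : b ≤ ballRadius (range γ) := by
  refine le_sInf ?_
  rintro _ ⟨r, ⟨hr, hne⟩, rfl⟩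
  exact h r hr ((hγ.tangentBalls_inter_nonempty_iff hr).1 hne)

/-! ### Thickness equals ball radius. -/

theorem sub_mem_normalSpace_of_isLocalMin (hγ : IsSimpleClosedC11Curve γ L) {t : ℝ} {c : E}
    (h : IsLocalMin (fun s => ‖c - γ s‖ ^ 2) t) : c - γ t ∈ normalSpace (range γ) (γ t) := by
  rw [hγ.mem_normalSpace_iff]
  have h1 := ((hγ.hasDerivAt t).const_sub c).norm_sq
  have h2 := h.hasDerivAt_eq_zero h1
  rw [inner_neg_right, real_inner_comm] at h2
  linarith

theorem injOn_expMap (hγ : IsSimpleClosedC11Curve γ L) {ρ : ℝ}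
    (h : ∀ r, 0 < r → r < ρ → ¬ MeetsTangentBall γ r) :
    InjOn expMap (normalDiscBundle (range γ) ρ) := by
  -- If `w` is the shorter vector, its foot lies in the closed ball of radius `‖v‖` tangent at `γ
  -- t`, hence in the open tangent ball of any larger radius.
  have key : ∀ t s : ℝ, ∀ v w : E, v ∈ normalSpace (range γ) (γ t) → ‖v‖ < ρ →
      γ t + v = γ s + w → ‖w‖ ≤ ‖v‖ → γ t = γ s := by
    intro t s v w hv hvρ heq hwv
    by_contra hne
    have hv0 : 0 < ‖v‖ := by
      rw [norm_pos_iff]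
      rintro rfl
      have : w = 0 := by simpa using hwv
      exact hne (by simpa [this] using heq)
    obtain ⟨r, hr1, hr2⟩ := exists_between hvρ
    refine h r (hv0.trans hr1) hr2 ⟨t, s, ‖v‖⁻¹ • v, ?_, ?_, ?_⟩
    · rw [inner_smul_right, hγ.mem_normalSpace_iff.1 hv, mul_zero]
    · simp [norm_smul, hv0.ne']
    · have hd : 0 < ‖γ s - γ t‖ ^ 2 := by
        have := norm_pos_iff.2 (sub_ne_zero.2 (Ne.symm hne))
        positivity
      have hw : w = -((γ s - γ t) - v) := by
        rw [neg_sub, sub_sub_eq_add_sub, add_comm v, heq]; abel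
      have h1 : ‖γ s - γ t‖ ^ 2 ≤ 2 * inner ℝ (γ s - γ t) v := by
        have h2 : ‖w‖ ^ 2 ≤ ‖v‖ ^ 2 := by gcongr
        rw [hw, norm_neg, norm_sub_sq_real] at h2
        linarith
      rw [inner_smul_right]
      have h3 : 1 < r * ‖v‖⁻¹ := by rwa [← div_eq_mul_inv, one_lt_div hv0]
      nlinarith
  rintro ⟨_, v⟩ ⟨⟨t, rfl⟩, hv, hv'⟩ ⟨_, w⟩ ⟨⟨s, rfl⟩, hw, hw'⟩ heq
  simp only [expMap] at heq hv hw hv' hw'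
  have hp : γ t = γ s := by
    rcases le_total ‖w‖ ‖v‖ with hle | hle
    · exact key t s v w hv hv' heq hle
    · exact (key s t w v hw hw' heq.symm hle).symm
  rw [hp] at heq ⊢
  rw [add_left_cancel heq]

/-- The centre `c` of the ball is the endpoint of a normal vector of length `r`, and also of the one
from its nearest point on the curve, which is shorter than `r`. -/
theorem not_injOn_expMap (hγ : IsSimpleClosedC11Curve γ L) {r r' : ℝ} (hr : 0 < r) (hrr' : r < r')
    (h : MeetsTangentBall γ r) : ¬ InjOn expMap (normalDiscBundle (range γ) r') := by
  intro hinj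
  obtain ⟨t, s, w, hw, hw1, hlt⟩ := h
  have hball := (mem_ball_add_smul_iff hw1 _ hr).2 hlt
  set c := γ t + r • w with hc
  obtain ⟨_, ⟨u, rfl⟩, hu⟩ := hγ.isCompact_range.exists_isMinOn (range_nonempty γ)
    (f := fun x => ‖c - x‖ ^ 2) (by fun_prop)
  have hu' : ∀ x, ‖c - γ u‖ ^ 2 ≤ ‖c - γ x‖ ^ 2 := fun x => hu (mem_range_self x)
  have hn := hγ.sub_mem_normalSpace_of_isLocalMin (t := u) (c := c) (Eventually.of_forall hu')
  have hlt' : ‖c - γ u‖ < r := by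
    refine lt_of_le_of_lt ((sq_le_sq₀ (norm_nonneg _) (norm_nonneg _)).1 (hu' s)) ?_
    rwa [mem_ball_iff_norm'] at hball
  have hrw : ‖r • w‖ = r := by rw [norm_smul, hw1, mul_one, Real.norm_of_nonneg hr.le]
  have h1 : (γ t, r • w) ∈ normalDiscBundle (range γ) r' := by
    refine ⟨mem_range_self _, hγ.mem_normalSpace_iff.2 ?_, by rw [hrw]; exact hrr'⟩
    simp [inner_smul_right, hw]
  have h2 : (γ u, c - γ u) ∈ normalDiscBundle (range γ) r' :=
    ⟨mem_range_self _, hn, hlt'.trans hrr'⟩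
  have h3 := hinj h1 h2 (by simp [expMap, hc])
  have h4 : r • w = c - γ u := congrArg Prod.snd h3
  rw [← h4, hrw] at hlt'
  exact lt_irrefl _ hlt'

theorem normalInjectivityRadius_eq_ballRadius (hγ : IsSimpleClosedC11Curve γ L) :
    normalInjectivityRadius (range γ) = ballRadius (range γ) := by
  apply le_antisymm
  · refine sSup_le ?_
    rintro _ (rfl | ⟨ρ, ⟨hρ, hinj⟩, rfl⟩)
    · exact zero_le
    · refine hγ.le_ballRadius fun r hr hm => ENNReal.ofReal_le_ofReal ?_
      by_contra! hlt
      exact hγ.not_injOn_expMap hr hlt hm hinj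
  · refine ENNReal.le_of_forall_nnreal_lt fun ρ hρ => ?_
    rcases eq_or_ne ρ 0 with rfl | h0
    · simp
    have hpos : (0 : ℝ) < ρ := by positivity
    refine le_sSup (Or.inr ⟨ρ, ⟨hpos, hγ.injOn_expMap fun r hr hrρ hm => ?_⟩, by simp⟩)
    have h1 : ballRadius (range γ) ≤ ENNReal.ofReal r :=
      sInf_le ⟨r, ⟨hr, (hγ.tangentBalls_inter_nonempty_iff hr).2 hm⟩, rfl⟩
    have h2 : ENNReal.ofReal r < ENNReal.ofReal ρ := (ENNReal.ofReal_lt_ofReal_iff hpos).2 hrρ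
    rw [ENNReal.ofReal_coe_nnreal] at h2
    exact absurd (hρ.trans_le h1) h2.not_gt

/-! ### Upper bounds for the ball radius. -/

theorem ballRadius_le_minDoubleCriticalDist_half (hγ : IsSimpleClosedC11Curve γ L) :
    ballRadius (range γ) ≤ minDoubleCriticalDist (range γ) / 2 := by
  rw [ENNReal.le_div_iff_mul_le (by simp) (by simp)]
  refine le_sInf ?_
  rintro _ ⟨_, _, ⟨⟨t, rfl⟩, ⟨s, rfl⟩, hne, ht, -⟩, rfl⟩
  have hd : 0 < ‖γ s - γ t‖ := norm_pos_iff.2 (sub_ne_zero.2 hne.symm)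
  rw [← ENNReal.le_div_iff_mul_le (by simp) (by simp), edist_comm, edist_dist, dist_eq_norm,
    ← ENNReal.ofReal_ofNat 2, ← ENNReal.ofReal_div_of_pos (by norm_num)]
  refine hγ.ballRadius_le (by positivity) fun r hr =>
    ⟨t, s, ‖γ s - γ t‖⁻¹ • (γ s - γ t), ?_, ?_, ?_⟩
  · rw [inner_smul_right, hγ.mem_normalSpace_iff.1 ht, mul_zero]
  · simp [norm_smul, hd.ne']
  · rw [inner_smul_right, real_inner_self_eq_norm_sq]
    have : ‖γ s - γ t‖⁻¹ * ‖γ s - γ t‖ ^ 2 = ‖γ s - γ t‖ := by field_simp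
    rw [this]
    nlinarith

/-- With `w` the direction of `T'`, the squared distance to the centre minus `r ^ 2` has second
derivative `2 * ‖γ'‖ * (‖γ'‖ - r * ‖T'‖) < 0` at its critical point `t`, so the curve must enter the
ball. -/
theorem meetsTangentBall_of_one_lt_mul_curvature (hγ : IsSimpleClosedC11Curve γ L) {t r : ℝ}
    (hd : DifferentiableAt ℝ (deriv γ) t) (hr : 0 < r) (h : 1 < r * curvature γ t) :
    MeetsTangentBall γ r := by
  have hv : 0 < ‖deriv γ t‖ := norm_pos_iff.2 (hγ.regular t)
  have hT : HasDerivAt (unitTangent γ) (deriv (unitTangent γ) t) t :=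
    ((hd.norm ℝ (hγ.regular t)).inv hv.ne').smul hd |>.hasDerivAt
  set D := deriv (unitTangent γ) t with hD
  have hDpos : 0 < ‖D‖ := by
    by_contra! hcon
    have : curvature γ t = 0 := by
      simp [curvature, ← hD, le_antisymm hcon (norm_nonneg _)]
    rw [this] at h
    linarith
  have horth : inner ℝ (deriv γ t) D = 0 := by
    have h1 : HasDerivAt (fun s => ‖unitTangent γ s‖ ^ 2) (2 * inner ℝ (unitTangent γ t) D) t :=
      hT.norm_sq
    have h2 : (fun s => ‖unitTangent γ s‖ ^ 2) = fun _ => 1 := by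
      ext s; rw [hγ.norm_unitTangent]; norm_num
    rw [h2] at h1
    have h3 := h1.unique (hasDerivAt_const t (1 : ℝ))
    rw [hγ.deriv_eq_norm_smul_unitTangent t, inner_smul_left]
    simp only [RCLike.conj_to_real]
    rw [show inner ℝ (unitTangent γ t) D = 0 by linarith, mul_zero]
  set w := ‖D‖⁻¹ • D with hw
  have hw1 : ‖w‖ = 1 := by simp [hw, norm_smul, hDpos.ne']
  have hwo : inner ℝ (deriv γ t) w = 0 := by rw [hw, inner_smul_right, horth, mul_zero]
  have hγ2 : inner ℝ (deriv (deriv γ) t) w = ‖deriv γ t‖ * ‖D‖ := by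
    have h1 : HasDerivAt (deriv γ) (‖deriv γ t‖ • D +
        deriv (fun s => ‖deriv γ s‖) t • unitTangent γ t) t := by
      have h2 := (hd.norm ℝ (hγ.regular t)).hasDerivAt.smul hT
      refine h2.congr_of_eventuallyEq (Eventually.of_forall fun s => ?_)
      exact hγ.deriv_eq_norm_smul_unitTangent s
    have h3 : inner ℝ (unitTangent γ t) w = 0 := by
      rw [unitTangent, inner_smul_left, hwo, mul_zero]
    rw [h1.deriv, inner_add_left, inner_smul_left, inner_smul_left, h3, hw, inner_smul_right,
      real_inner_self_eq_norm_sq]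
    simp only [RCLike.conj_to_real]
    field_simp
    ring
  by_contra hcon
  have hge : ∀ s, 0 ≤ ‖γ s - γ t‖ ^ 2 - 2 * r * inner ℝ (γ s - γ t) w := by
    intro s
    by_contra! hlt
    exact hcon ⟨t, s, w, hwo, hw1, by linarith⟩
  set φ : ℝ → ℝ := fun s => ‖γ s - γ t‖ ^ 2 - 2 * r * inner ℝ (γ s - γ t) w with hφ
  have hφ1 : ∀ s, HasDerivAt φ
      (2 * inner ℝ (γ s - γ t) (deriv γ s) - 2 * r * inner ℝ (deriv γ s) w) s := by
    intro s
    have h1 := (hγ.hasDerivAt s).sub_const (γ t)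
    have h2 := h1.inner ℝ (hasDerivAt_const s w)
    simp only [inner_zero_right, zero_add] at h2
    exact h1.norm_sq.sub (h2.const_mul (2 * r))
  have hφ2 : HasDerivAt (deriv φ)
      (2 * ‖deriv γ t‖ ^ 2 - 2 * r * (‖deriv γ t‖ * ‖D‖)) t := by
    have h0 : deriv φ = fun s =>
        2 * inner ℝ (γ s - γ t) (deriv γ s) - 2 * r * inner ℝ (deriv γ s) w :=
      funext fun s => (hφ1 s).deriv
    rw [h0]
    have h1 := ((hγ.hasDerivAt t).sub_const (γ t)).inner ℝ hd.hasDerivAt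
    have h2 := hd.hasDerivAt.inner ℝ (hasDerivAt_const t w)
    simp only [inner_zero_right, zero_add, sub_self, inner_zero_left,
      real_inner_self_eq_norm_sq, hγ2] at h1 h2
    exact (h1.const_mul 2).sub (h2.const_mul (2 * r))
  have hneg : deriv (deriv φ) t < 0 := by
    rw [hφ2.deriv]
    have h1 : r * curvature γ t * ‖deriv γ t‖ = r * ‖D‖ := by
      rw [curvature, ← hD]; field_simp
    have h2 : ‖deriv γ t‖ < r * ‖D‖ := by rw [← h1]; exact lt_mul_of_one_lt_left hv h
    nlinarith
  have hφt : φ t = 0 := by simp [hφ]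
  have hd0 : deriv φ t = 0 := by rw [(hφ1 t).deriv]; simp [hwo]
  have hmax := isLocalMax_of_deriv_deriv_neg hneg hd0 (hφ1 t).continuousAt
  -- A local maximum of value `0` of a nonnegative function makes `φ` vanish near `t`, against `φ''
  -- < 0`. Only differentiability of `γ'` at `t` itself is needed.
  have hev : φ =ᶠ[𝓝 t] fun _ => 0 := by
    filter_upwards [hmax] with s hs
    exact le_antisymm (hφt ▸ hs) (hge s)
  have := hev.deriv.deriv_eq
  simp at this
  linarith

theorem ballRadius_le_inv_supCurvature (hγ : IsSimpleClosedC11Curve γ L) :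
    ballRadius (range γ) ≤ (supCurvature γ)⁻¹ := by
  rw [← ENNReal.le_inv_iff_le_inv]
  refine iSup₂_le fun t ht => ?_
  rw [ENNReal.le_inv_iff_le_inv]
  rcases (show 0 ≤ curvature γ t by unfold curvature; positivity).eq_or_lt with h0 | h0
  · simp [← h0]
  rw [← ENNReal.ofReal_inv_of_pos h0]
  refine hγ.ballRadius_le (by positivity) fun r hr => ?_
  exact hγ.meetsTangentBall_of_one_lt_mul_curvature ht
    ((by positivity : 0 < (curvature γ t)⁻¹).trans hr)
    ((inv_lt_iff_one_lt_mul₀ h0).1 hr)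

end IsSimpleClosedC11Curve

/-! ### Curvature bounds and local separation from tangent balls. -/

/-- Arc length along `γ`, measured from the parameter `0`. -/
def arcLength (γ : ℝ → E) (s : ℝ) : ℝ := ∫ u in (0 : ℝ)..s, ‖deriv γ u‖

theorem exists_uIcc_sub_eq_mul {φ φ' : ℝ → ℝ} (h : ∀ u, HasDerivAt φ (φ' u) u) (t s : ℝ) :
    ∃ u ∈ uIcc t s, φ s - φ t = φ' u * (s - t) := by
  have key : ∀ a b, a < b → ∃ u ∈ uIcc a b, φ b - φ a = φ' u * (b - a) := by
    intro a b hab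
    obtain ⟨u, hu, h1⟩ := exists_hasDerivAt_eq_slope φ φ' hab
      (fun x _ => (h x).continuousAt.continuousWithinAt) (fun x _ => h x)
    refine ⟨u, Icc_subset_uIcc (Ioo_subset_Icc_self hu), ?_⟩
    rw [h1, div_mul_cancel₀ _ (sub_pos.2 hab).ne']
  rcases lt_trichotomy t s with hlt | rfl | hlt
  · exact key t s hlt
  · exact ⟨t, left_mem_uIcc, by simp⟩
  · obtain ⟨u, hu, h1⟩ := key s t hlt
    exact ⟨u, by rwa [uIcc_comm], by linarith⟩

namespace IsSimpleClosedC11Curve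

variable {γ : ℝ → E} {L : ℝ}

theorem hasDerivAt_arcLength (hγ : IsSimpleClosedC11Curve γ L) (s : ℝ) :
    HasDerivAt (arcLength γ) ‖deriv γ s‖ s :=
  intervalIntegral.integral_hasDerivAt_right
    (hγ.continuous_deriv.norm.intervalIntegrable _ _)
    hγ.continuous_deriv.norm.stronglyMeasurable.stronglyMeasurableAtFilter
    hγ.continuous_deriv.norm.continuousAt

theorem strictMono_arcLength (hγ : IsSimpleClosedC11Curve γ L) : StrictMono (arcLength γ) :=
  strictMono_of_hasDerivAt_pos hγ.hasDerivAt_arcLength fun s => norm_pos_iff.2 (hγ.regular s)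

/-- Pairing `T` with the fixed vector `e = T s - T t` gives a real Lipschitz function, the integral
of its a.e. derivative; the curvature bound then yields `‖e‖ ^ 2 ≤ ‖e‖ * k * ℓ`, with `ℓ` the arc
length. -/
theorem norm_unitTangent_sub_le [FiniteDimensional ℝ E] (hγ : IsSimpleClosedC11Curve γ L) {k : ℝ}
    (hk : ∀ t, DifferentiableAt ℝ (deriv γ) t → curvature γ t ≤ k) (s t : ℝ) :
    ‖unitTangent γ s - unitTangent γ t‖ ≤ k * |arcLength γ s - arcLength γ t| := by
  wlog hts : t ≤ s generalizing s t
  · rw [norm_sub_rev, abs_sub_comm]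
    exact this t s (le_of_not_ge hts)
  obtain ⟨C, hC⟩ := hγ.lipschitz_unitTangent
  obtain ⟨C', hC'⟩ := hγ.lipschitz_deriv
  rw [abs_of_nonneg (sub_nonneg.2 (hγ.strictMono_arcLength.monotone hts))]
  have hint := fun a b => hγ.continuous_deriv.norm.intervalIntegrable (μ := volume) a b
  have hl : arcLength γ s - arcLength γ t = ∫ u in t..s, ‖deriv γ u‖ :=
    intervalIntegral.integral_interval_sub_left (hint _ _) (hint _ _)
  rw [hl]
  set e := unitTangent γ s - unitTangent γ t with he
  set f : ℝ → ℝ := fun u => inner ℝ e (unitTangent γ u) with hf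
  have hfL : LipschitzWith (‖innerSL ℝ e‖₊ * C) f := (innerSL ℝ e).lipschitz.comp hC
  have hAC : AbsolutelyContinuousOnInterval f t s :=
    hfL.lipschitzOnWith.absolutelyContinuousOnInterval
  have h1 := hAC.integral_deriv_eq_sub
  have h2 : ∀ᵐ u, deriv f u ≤ ‖e‖ * (k * ‖deriv γ u‖) := by
    filter_upwards [hC'.ae_differentiableAt_real] with u hu
    have hv : 0 < ‖deriv γ u‖ := norm_pos_iff.2 (hγ.regular u)
    have hT : HasDerivAt (unitTangent γ) (deriv (unitTangent γ) u) u :=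
      ((hu.norm ℝ (hγ.regular u)).inv hv.ne').smul hu |>.hasDerivAt
    have h3 := (hasDerivAt_const u e).inner ℝ hT
    simp only [inner_zero_left, add_zero] at h3
    rw [h3.deriv]
    refine (real_inner_le_norm _ _).trans ?_
    gcongr
    exact (div_le_iff₀ hv).1 (hk u hu)
  have h3 : ∫ u in t..s, deriv f u ≤ ∫ u in t..s, ‖e‖ * (k * ‖deriv γ u‖) :=
    intervalIntegral.integral_mono_ae hts hAC.intervalIntegrable_deriv
      (((hint t s).const_mul k).const_mul ‖e‖) h2
  rw [h1, intervalIntegral.integral_const_mul, intervalIntegral.integral_const_mul] at h3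
  have h4 : f s - f t = ‖e‖ * ‖e‖ := by
    rw [hf]; simp only; rw [← inner_sub_right, ← he, real_inner_self_eq_norm_mul_norm]
  rw [h4] at h3
  rcases (norm_nonneg e).eq_or_lt with h0 | h0
  · rw [← h0]
    by_contra! hneg
    have hk0 : 0 ≤ k := by
      obtain ⟨u, hu⟩ := hC'.ae_differentiableAt_real.exists
      exact (by unfold curvature; positivity : 0 ≤ curvature γ u).trans (hk u hu)
    have : 0 ≤ ∫ u in t..s, ‖deriv γ u‖ :=
      intervalIntegral.integral_nonneg hts fun u _ => norm_nonneg _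
    exact absurd (mul_nonneg hk0 this) hneg.not_ge
  · exact le_of_mul_le_mul_left h3 h0

/-- At arc length `ℓ` from `γ t`, the normal displacement is at most `k * ℓ ^ 2 / 2`, while the
chord is at least `c * |ℓ|` with `c` close to `1`. Hence `r * k < c ^ 2` keeps nearby points off the
closed ball; the speed bound `M` makes `δ` uniform. -/
theorem exists_forall_lt_norm_sub_sq (hγ : IsSimpleClosedC11Curve γ L) {k r : ℝ} (hk : 0 ≤ k)
    (hr : 0 ≤ r) (hrk : r * k < 1)
    (hT : ∀ s t, ‖unitTangent γ s - unitTangent γ t‖ ≤ k * |arcLength γ s - arcLength γ t|) :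
    ∃ δ > 0, ∀ t s : ℝ, s ≠ t → |s - t| ≤ δ → ∀ w, inner ℝ (deriv γ t) w = 0 → ‖w‖ = 1 →
      2 * r * inner ℝ (γ s - γ t) w < ‖γ s - γ t‖ ^ 2 := by
  obtain ⟨m, M, hm, hmM⟩ := hγ.exists_speed_bounds
  obtain ⟨δ, hδ0, hδ⟩ : ∃ δ > 0, (k * (M * δ)) ^ 2 < 1 - r * k := by
    have h1 : ∀ᶠ δ in 𝓝[>] (0 : ℝ), (k * (M * δ)) ^ 2 < 1 - r * k :=
      nhdsWithin_le_nhds (ContinuousAt.eventually_lt (by fun_prop) (by fun_prop) (by simpa))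
    obtain ⟨δ, h2, h3⟩ := (h1.and self_mem_nhdsWithin).exists
    exact ⟨δ, h3, h2⟩
  refine ⟨δ, hδ0, fun t s hst hsδ w hw hw1 => ?_⟩
  set ℓ : ℝ → ℝ := fun u => arcLength γ u - arcLength γ t with hℓ
  have hℓ' : ∀ u, HasDerivAt ℓ ‖deriv γ u‖ u := fun u =>
    (hγ.hasDerivAt_arcLength u).sub_const _
  have hℓt : ℓ t = 0 := by simp [hℓ]
  have hℓs : 0 < ℓ s ^ 2 := by
    have : ℓ s ≠ 0 := sub_ne_zero.2 fun h => hst (hγ.strictMono_arcLength.injective h)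
    positivity
  have hsign : ∀ u ∈ uIcc t s, 0 ≤ ℓ u * (s - t) := by
    intro u hu
    rcases le_total t s with h | h
    · rw [uIcc_of_le h] at hu
      exact mul_nonneg (sub_nonneg.2 (hγ.strictMono_arcLength.monotone hu.1)) (sub_nonneg.2 h)
    · rw [uIcc_of_ge h] at hu
      exact mul_nonneg_of_nonpos_of_nonpos
        (sub_nonpos.2 (hγ.strictMono_arcLength.monotone hu.2)) (sub_nonpos.2 h)
  have hℓb : ∀ u ∈ uIcc t s, |ℓ u| ≤ M * δ := by
    intro u hu
    obtain ⟨x, -, hx⟩ := exists_uIcc_sub_eq_mul hℓ' t u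
    rw [hℓt, sub_zero] at hx
    rw [hx, abs_mul, abs_norm]
    have h1 : |u - t| ≤ δ := (abs_sub_left_of_mem_uIcc hu).trans hsδ
    have hM : 0 ≤ M := hm.le.trans ((hmM 0).1.trans (hmM 0).2)
    exact mul_le_mul (hmM x).2 h1 (abs_nonneg _) hM
  have hγ' : ∀ (x : E) u, HasDerivAt (fun u => inner ℝ (γ u - γ t) x)
      (‖deriv γ u‖ * inner ℝ (unitTangent γ u) x) u := by
    intro x u
    have h1 := ((hγ.hasDerivAt u).sub_const (γ t)).inner ℝ (hasDerivAt_const u x)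
    rw [hγ.deriv_eq_norm_smul_unitTangent u] at h1
    simpa [inner_smul_left, norm_smul, hγ.norm_unitTangent] using h1
  have hTw : inner ℝ (unitTangent γ t) w = 0 := by
    rw [unitTangent, inner_smul_left, hw, mul_zero]
  have hup : 2 * inner ℝ (γ s - γ t) w ≤ k * ℓ s ^ 2 := by
    obtain ⟨u, hu, h1⟩ := exists_uIcc_sub_eq_mul
      (fun u => (((hℓ' u).pow 2).const_mul (k / 2)).sub (hγ' w u)) t s
    simp only [Pi.sub_apply, Pi.pow_apply, hℓt, sub_self, inner_zero_left] at h1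
    have h2 : |inner ℝ (unitTangent γ u) w| ≤ k * |ℓ u| := by
      have h3 := abs_real_inner_le_norm (unitTangent γ u - unitTangent γ t) w
      rw [hw1, mul_one, inner_sub_left, hTw, sub_zero] at h3
      exact h3.trans (hT u t)
    have h3 : inner ℝ (unitTangent γ u) w * (s - t) ≤ k * (ℓ u * (s - t)) := by
      refine (le_abs_self _).trans ?_
      rw [abs_mul, ← abs_of_nonneg (hsign u hu), abs_mul, ← mul_assoc]
      gcongr
    have h4 := mul_le_mul_of_nonneg_left h3 (norm_nonneg (deriv γ u))
    norm_num at h1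
    nlinarith
  -- For unit vectors `⟪a, b⟫ = 1 - ‖a - b‖ ^ 2 / 2`, so `c` bounds the cosine of the turning angle
  -- from below. The choice of `δ` gives `c ^ 2 > r * k`.
  set c : ℝ := 1 - (k * (M * δ)) ^ 2 / 2 with hc
  have hrk0 : 0 ≤ r * k := mul_nonneg hr hk
  have hc0 : 0 < c := by linarith
  have hlow : c ^ 2 * ℓ s ^ 2 ≤ ‖γ s - γ t‖ ^ 2 := by
    obtain ⟨u, hu, h1⟩ := exists_uIcc_sub_eq_mul
      (fun u => (hγ' (unitTangent γ t) u).sub ((hℓ' u).const_mul c)) t s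
    simp only [Pi.sub_apply, hℓt, sub_self, inner_zero_left, mul_zero, sub_zero] at h1
    have h2 : c ≤ inner ℝ (unitTangent γ u) (unitTangent γ t) := by
      have h3 : ‖unitTangent γ u - unitTangent γ t‖ ^ 2 ≤ (k * (M * δ)) ^ 2 := by
        gcongr
        exact (hT u t).trans (mul_le_mul_of_nonneg_left (hℓb u hu) hk)
      rw [norm_sub_sq_real, hγ.norm_unitTangent, hγ.norm_unitTangent] at h3
      linarith
    have h3 : 0 ≤ (inner ℝ (γ s - γ t) (unitTangent γ t) - c * ℓ s) * (s - t) := by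
      rw [h1, mul_comm c, ← mul_sub, mul_assoc, ← sq]
      have := norm_nonneg (deriv γ u)
      have := sub_nonneg.2 h2
      positivity
    have h4 := hsign s right_mem_uIcc
    have h5 : (c * ℓ s) ^ 2 ≤ inner ℝ (γ s - γ t) (unitTangent γ t) ^ 2 := by
      rw [sq_le_sq]
      rcases lt_or_gt_of_ne hst with h | h
      · have h6 : ℓ s ≤ 0 := nonpos_of_mul_nonneg_left h4 (sub_neg.2 h)
        have h7 := nonpos_of_mul_nonneg_left h3 (sub_neg.2 h)
        have h8 : c * ℓ s ≤ 0 := mul_nonpos_of_nonneg_of_nonpos hc0.le h6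
        rw [abs_of_nonpos h8, abs_of_nonpos (by linarith)]
        linarith
      · have h6 : 0 ≤ ℓ s := nonneg_of_mul_nonneg_left h4 (sub_pos.2 h)
        have h7 := nonneg_of_mul_nonneg_left h3 (sub_pos.2 h)
        have h8 : 0 ≤ c * ℓ s := mul_nonneg hc0.le h6
        rw [abs_of_nonneg h8, abs_of_nonneg (by linarith)]
        linarith
    rw [← mul_pow]
    refine h5.trans ?_
    rw [← sq_abs]
    gcongr
    simpa [hγ.norm_unitTangent] using
      abs_real_inner_le_norm (γ s - γ t) (unitTangent γ t)
  have h5 : r * k < c ^ 2 := by nlinarith [sq_nonneg ((k * (M * δ)) ^ 2)]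
  calc 2 * r * inner ℝ (γ s - γ t) w = r * (2 * inner ℝ (γ s - γ t) w) := by ring
    _ ≤ r * (k * ℓ s ^ 2) := by gcongr
    _ = r * k * ℓ s ^ 2 := by ring
    _ < c ^ 2 * ℓ s ^ 2 := by gcongr
    _ ≤ _ := hlow
-- Least touching radius and double critical pairs.
theorem exists_foot_mem_Icc (hγ : IsSimpleClosedC11Curve γ L) {a b t : ℝ} (ht : t ∈ Icc a b) {c : E}
    (ha : ‖γ t - c‖ < ‖γ a - c‖) (hb : ‖γ t - c‖ < ‖γ b - c‖) :
    ∃ u ∈ Icc a b, c - γ u ∈ normalSpace (range γ) (γ u) ∧ ‖c - γ u‖ ≤ ‖γ t - c‖ := by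
  obtain ⟨u, hu, hmin⟩ := isCompact_Icc.exists_isMinOn ⟨t, ht⟩
    (f := fun s => ‖c - γ s‖ ^ 2) ((continuous_const.sub hγ.continuous).norm.pow 2).continuousOn
  have hle : ∀ s ∈ Icc a b, ‖γ u - c‖ ≤ ‖γ s - c‖ := fun s hs => by
    rw [norm_sub_rev, norm_sub_rev (γ s)]
    exact (sq_le_sq₀ (norm_nonneg _) (norm_nonneg _)).1 (hmin hs)
  have hua : u ≠ a := by rintro rfl; exact ((hle t ht).trans_lt ha).false
  have hub : u ≠ b := by rintro rfl; exact ((hle t ht).trans_lt hb).false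
  refine ⟨u, hu, hγ.sub_mem_normalSpace_of_isLocalMin ?_, ?_⟩
  · exact hmin.isLocalMin
      (Icc_mem_nhds (lt_of_le_of_ne hu.1 (Ne.symm hua)) (lt_of_le_of_ne hu.2 hub))
  · rw [norm_sub_rev]; exact hle t ht

theorem exists_minimal_touching [FiniteDimensional ℝ E] (hγ : IsSimpleClosedC11Curve γ L)
    {r δ : ℝ} (hr : 0 < r) (hδ : 0 < δ)
    (hsep : ∀ t s : ℝ, s ≠ t → |s - t| ≤ δ → ∀ w, inner ℝ (deriv γ t) w = 0 → ‖w‖ = 1 →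
      2 * r * inner ℝ (γ s - γ t) w < ‖γ s - γ t‖ ^ 2)
    (hmeet : MeetsTangentBall γ r) :
    ∃ ρ, 0 < ρ ∧ ρ ≤ r ∧ ¬ MeetsTangentBall γ ρ ∧ ∃ t s w, inner ℝ (deriv γ t) w = 0 ∧ ‖w‖ = 1 ∧
      γ s ≠ γ t ∧ ‖γ s - γ t‖ ^ 2 = 2 * ρ * inner ℝ (γ s - γ t) w := by
  have hL := hγ.period_pos
  have hc := hγ.continuous
  have hc' := hγ.continuous_deriv
  -- Taking `t` in one period and `s` in `[t, t + L)` accounts for `2 * L`. The gap `δ` is imposed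
  -- at both ends, since `s` near `t + L` is again near `t` on the curve; it keeps the diagonal out
  -- of this compact set.
  let A : Set (ℝ × ℝ × E × ℝ) :=
    (Icc 0 L ×ˢ Icc 0 (2 * L) ×ˢ Metric.sphere 0 1 ×ˢ Icc 0 r) ∩
      ({x | δ ≤ x.2.1 - x.1} ∩ {x | x.2.1 - x.1 ≤ L - δ} ∩
        {x | inner ℝ (deriv γ x.1) x.2.2.1 = 0} ∩
        {x | ‖γ x.2.1 - γ x.1‖ ^ 2 ≤ 2 * x.2.2.2 * inner ℝ (γ x.2.1 - γ x.1) x.2.2.1})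
  have hA : IsCompact A := by
    refine (isCompact_Icc.prod (isCompact_Icc.prod
      ((isCompact_sphere _ _).prod isCompact_Icc))).inter_right ?_
    refine ((IsClosed.inter ?_ ?_).inter ?_).inter ?_
    · exact isClosed_le (by fun_prop) (by fun_prop)
    · exact isClosed_le (by fun_prop) (by fun_prop)
    · exact isClosed_eq (by fun_prop) (by fun_prop)
    · exact isClosed_le (by fun_prop) (by fun_prop)
  have hmem : ∀ r', 0 < r' → r' ≤ r → MeetsTangentBall γ r' → ∃ t s w, (t, s, w, r') ∈ A := by
    rintro r' hr' hr'r ⟨t', s', w, hw, hw1, hlt⟩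
    obtain ⟨t, ht, htt⟩ : ∃ t ∈ Ico 0 L, γ t' = γ t ∧ deriv γ t' = deriv γ t := by
      have hp : Function.Periodic (fun u => (γ u, deriv γ u)) L := fun u => by
        simp only [hγ.periodic u, hγ.periodic_deriv u]
      obtain ⟨t, ht, h⟩ := hp.exists_mem_Ico₀ hL t'
      exact ⟨t, ht, congrArg Prod.fst h, congrArg Prod.snd h⟩
    obtain ⟨s, hs, hss⟩ := hγ.periodic.exists_mem_Ico hL s' t
    rw [htt.2] at hw
    rw [htt.1, hss] at hlt
    have hlt' : ‖γ s - γ t‖ ^ 2 ≤ 2 * r * inner ℝ (γ s - γ t) w := by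
      have h1 : 0 ≤ inner ℝ (γ s - γ t) w := by
        by_contra! hneg
        have := sq_nonneg ‖γ s - γ t‖
        nlinarith
      have := mul_le_mul_of_nonneg_right hr'r h1
      linarith
    have hne : γ s ≠ γ t := fun h => by simp [h] at hlt
    have h1 : δ ≤ s - t := by
      by_contra! hcon
      refine (hsep t s (fun h => hne (h ▸ rfl)) ?_ w hw hw1).not_ge hlt'
      rw [abs_of_nonneg (by linarith [hs.1])]
      exact hcon.le
    have h2 : s - t ≤ L - δ := by
      by_contra! hcon
      have h3 := hsep t (s - L) (by linarith [hs.2] : s - L < t).ne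
        (by rw [abs_of_nonpos (by linarith [hs.2])]; linarith) w hw hw1
      rw [hγ.periodic.sub_eq] at h3
      exact h3.not_ge hlt'
    exact ⟨t, s, w, ⟨Ico_subset_Icc_self ht,
      ⟨by linarith [hs.1, ht.1], by linarith [hs.2, ht.2]⟩, by simpa using hw1, hr'.le, hr'r⟩,
      ⟨⟨h1, h2⟩, hw⟩, hlt.le⟩
  obtain ⟨t₀, s₀, w₀, h₀⟩ := hmem r hr le_rfl hmeet
  obtain ⟨⟨t, s, w, ρ⟩, hx, hmin⟩ := hA.exists_isMinOn ⟨_, h₀⟩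
    (f := fun x => x.2.2.2) (Continuous.continuousOn (by fun_prop))
  obtain ⟨⟨-, -, hw1, hρ0, hρr⟩, ⟨⟨h1, h2⟩, hw⟩, hle⟩ := hx
  simp only [mem_sphere_iff_norm, sub_zero, mem_ofPred_eq] at hw1 hρ0 hρr h1 h2 hw hle
  have hne : γ s ≠ γ t := by
    intro h
    have := hγ.eq_of_mem_Ico (a := t) ⟨by linarith, by linarith⟩ ⟨le_rfl, by linarith⟩ h
    linarith
  have hpos : 0 < ‖γ s - γ t‖ ^ 2 := by
    have := norm_pos_iff.2 (sub_ne_zero.2 hne)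
    positivity
  have hρ : 0 < ρ := by
    refine lt_of_le_of_ne hρ0 ?_
    rintro rfl
    simp at hle
    exact hne (sub_eq_zero.1 hle)
  have hnot : ¬ MeetsTangentBall γ ρ := by
    intro h
    obtain ⟨ρ', h3, h4, h5⟩ := h.exists_lt hρ
    obtain ⟨t', s', w', h6⟩ := hmem ρ' h3 (h4.le.trans hρr) h5
    exact h4.not_ge (hmin h6)
  refine ⟨ρ, hρ, hρr, hnot, t, s, w, hw, hw1, hne, le_antisymm hle ?_⟩
  by_contra! hlt
  exact hnot ⟨t, s, w, hw, hw1, hlt⟩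

/-- If `w + w' ≠ 0`, moving the centre by `-ε • (w + w')` brings it closer than `ρ` to both touching
points. Minimizing the distance over short disjoint arcs around them gives two distinct feet,
against injectivity on the normal disc bundle of radius `ρ`. -/
theorem eq_neg_of_touching (hγ : IsSimpleClosedC11Curve γ L) {ρ δ t s : ℝ} {c w w' : E}
    (hρ : 0 < ρ) (hδ : 0 < δ)
    (hsep : ∀ t s : ℝ, s ≠ t → |s - t| ≤ δ → ∀ w, inner ℝ (deriv γ t) w = 0 → ‖w‖ = 1 →
      2 * ρ * inner ℝ (γ s - γ t) w < ‖γ s - γ t‖ ^ 2)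
    (hnot : ¬ MeetsTangentBall γ ρ) (hw : inner ℝ (deriv γ t) w = 0) (hw1 : ‖w‖ = 1)
    (hw'o : inner ℝ (deriv γ s) w' = 0) (hw'1 : ‖w'‖ = 1) (hc : c = γ t + ρ • w)
    (hc' : c = γ s + ρ • w') (hne : γ s ≠ γ t) : w' = -w := by
  by_contra hopp
  have hcont := hγ.continuous
  have hww' : -1 < inner ℝ w w' := by
    have h1 : 0 < ‖w + w'‖ ^ 2 := by
      have : 0 < ‖w + w'‖ := norm_pos_iff.2 fun h => hopp (eq_neg_of_add_eq_zero_right h)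
      positivity
    rw [norm_add_sq_real, hw1, hw'1] at h1
    linarith
  obtain ⟨η, hη, hηδ, hdisj⟩ : ∃ η > 0, η ≤ δ ∧ ∀ u ∈ Icc (t - η) (t + η),
      ∀ v ∈ Icc (s - η) (s + η), γ u ≠ γ v := by
    have h1 : ∀ᶠ x : ℝ × ℝ in 𝓝 (t, s), γ x.1 ≠ γ x.2 :=
      (isOpen_ne_fun (hcont.comp continuous_fst) (hcont.comp continuous_snd)).mem_nhds hne.symm
    obtain ⟨ε, hε, h2⟩ := Metric.eventually_nhds_iff.1 h1
    refine ⟨min δ (ε / 2), by positivity, min_le_left _ _, fun u hu v hv => ?_⟩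
    have h3 := min_le_right δ (ε / 2)
    have h4 : dist (u, v) (t, s) < ε := by
      rw [Prod.dist_eq, max_lt_iff, Real.dist_eq, Real.dist_eq, abs_lt, abs_lt]
      exact ⟨⟨by linarith [hu.1], by linarith [hu.2]⟩, by linarith [hv.1], by linarith [hv.2]⟩
    exact h2 h4
  -- Strict separation puts the ends of each arc farther than `ρ` from `c`; this survives a small
  -- shift and forces interior minima.
  have hfar : ∀ τ v : ℝ, ∀ z : E, inner ℝ (deriv γ τ) z = 0 → ‖z‖ = 1 → c = γ τ + ρ • z →
      v ≠ τ → |v - τ| ≤ η → ρ < ‖γ v - c‖ := by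
    intro τ v z hz hz1 hcz hne hle
    rw [← sq_lt_sq₀ hρ.le (norm_nonneg _), hcz, norm_sub_add_smul_sq hz1]
    have h1 := hsep τ v hne (hle.trans hηδ) z hz hz1
    linarith
  have hclose : ∀ τ : ℝ, ∀ z : E, ‖z‖ = 1 → c = γ τ + ρ • z → 0 < inner ℝ z (w + w') →
      ∀ᶠ ε in 𝓝[>] (0 : ℝ), ‖γ τ - (c - ε • (w + w'))‖ < ρ := by
    intro τ z hz hcz hpos
    have h1 : ∀ᶠ ε in 𝓝[>] (0 : ℝ), ε * ‖w + w'‖ ^ 2 < 2 * ρ * inner ℝ z (w + w') :=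
      nhdsWithin_le_nhds (ContinuousAt.eventually_lt (Continuous.continuousAt (by fun_prop))
        continuousAt_const
        (by rw [zero_mul]; positivity))
    filter_upwards [h1, self_mem_nhdsWithin] with ε hε hε0
    have hε0 : 0 < ε := hε0
    have h2 : γ τ - (c - ε • (w + w')) = -(ρ • z - ε • (w + w')) := by rw [hcz]; abel
    rw [← sq_lt_sq₀ (norm_nonneg _) hρ.le, h2, norm_neg, norm_sub_sq_real, norm_smul, norm_smul,
      hz, inner_smul_left, inner_smul_right, Real.norm_of_nonneg hρ.le,
      Real.norm_of_nonneg hε0.le]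
    simp only [RCLike.conj_to_real]
    have := mul_lt_mul_of_pos_left hε hε0
    nlinarith
  have hstay : ∀ v, ρ < ‖γ v - c‖ → ∀ᶠ ε in 𝓝[>] (0 : ℝ), ρ < ‖γ v - (c - ε • (w + w'))‖ :=
    fun v hv => nhdsWithin_le_nhds
      (ContinuousAt.eventually_lt continuousAt_const (Continuous.continuousAt (by fun_prop))
        (by simpa using hv))
  have hη1 : |η| ≤ η := (abs_of_pos hη).le
  have hex : ∀ τ : ℝ, ∀ z : E, inner ℝ (deriv γ τ) z = 0 → ‖z‖ = 1 → c = γ τ + ρ • z →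
      0 < inner ℝ z (w + w') → ∀ᶠ ε in 𝓝[>] (0 : ℝ), ∃ u ∈ Icc (τ - η) (τ + η),
        (c - ε • (w + w')) - γ u ∈ normalSpace (range γ) (γ u) ∧
        ‖(c - ε • (w + w')) - γ u‖ < ρ := by
    intro τ z hz hz1 hcz hpos
    filter_upwards [hclose τ z hz1 hcz hpos,
      hstay _ (hfar τ (τ - η) z hz hz1 hcz (by linarith : τ - η < τ).ne (by simpa using hη1)),
      hstay _ (hfar τ (τ + η) z hz hz1 hcz (by linarith : τ < τ + η).ne' (by simpa using hη1))]
      with ε h1 h2 h3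
    obtain ⟨u, hu, hu1, hu2⟩ := hγ.exists_foot_mem_Icc (a := τ - η) (b := τ + η) (t := τ)
      ⟨by linarith, by linarith⟩ (h1.trans h2) (h1.trans h3)
    exact ⟨u, hu, hu1, hu2.trans_lt h1⟩
  obtain ⟨ε, ⟨u, hu, hu1, hu2⟩, v, hv, hv1, hv2⟩ := ((hex t w hw hw1 hc (by
      rw [inner_add_right, real_inner_self_eq_norm_sq, hw1]; linarith)).and
    (hex s w' hw'o hw'1 hc' (by
      rw [inner_add_right, real_inner_self_eq_norm_sq, hw'1, real_inner_comm]; linarith))).exists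
  have hinj := hγ.injOn_expMap (ρ := ρ) fun r' h1 h2 h3 => hnot (h3.mono h1 h2.le)
  have hmu : (γ u, (c - ε • (w + w')) - γ u) ∈ normalDiscBundle (range γ) ρ :=
    ⟨mem_range_self _, hu1, hu2⟩
  have hmv : (γ v, (c - ε • (w + w')) - γ v) ∈ normalDiscBundle (range γ) ρ :=
    ⟨mem_range_self _, hv1, hv2⟩
  have := hinj hmu hmv (by simp [expMap])
  exact hdisj u hu v hv (congrArg Prod.fst this)

theorem exists_isDoubleCriticalPair [FiniteDimensional ℝ E] (hγ : IsSimpleClosedC11Curve γ L)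
    {r δ : ℝ} (hr : 0 < r) (hδ : 0 < δ)
    (hsep : ∀ t s : ℝ, s ≠ t → |s - t| ≤ δ → ∀ w, inner ℝ (deriv γ t) w = 0 → ‖w‖ = 1 →
      2 * r * inner ℝ (γ s - γ t) w < ‖γ s - γ t‖ ^ 2)
    (hmeet : MeetsTangentBall γ r) :
    ∃ p q, IsDoubleCriticalPair (range γ) p q ∧ dist p q ≤ 2 * r := by
  obtain ⟨ρ, hρ, hρr, hnot, t, s, w, hw, hw1, hne, heq⟩ :=
    hγ.exists_minimal_touching hr hδ hsep hmeet
  have hcont := hγ.continuous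
  obtain ⟨c, hc⟩ : ∃ c, c = γ t + ρ • w := ⟨_, rfl⟩
  have hge : ∀ u, ρ ≤ ‖γ u - c‖ := by
    intro u
    rw [← sq_le_sq₀ hρ.le (norm_nonneg _), hc, norm_sub_add_smul_sq hw1]
    by_contra! hlt
    exact hnot ⟨t, u, w, hw, hw1, by linarith⟩
  have hsc : ‖γ s - c‖ = ρ := by
    rw [← sq_eq_sq₀ (norm_nonneg _) hρ.le, hc, norm_sub_add_smul_sq hw1]
    linarith
  obtain ⟨w', hw'⟩ : ∃ w', w' = ρ⁻¹ • (c - γ s) := ⟨_, rfl⟩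
  have hw'1 : ‖w'‖ = 1 := by
    rw [hw', norm_smul, norm_sub_rev, hsc, norm_inv, Real.norm_of_nonneg hρ.le,
      inv_mul_cancel₀ hρ.ne']
  have hc' : c = γ s + ρ • w' := by
    rw [hw', smul_smul, mul_inv_cancel₀ hρ.ne', one_smul]; abel
  have hns : c - γ s ∈ normalSpace (range γ) (γ s) := by
    refine hγ.sub_mem_normalSpace_of_isLocalMin (Eventually.of_forall fun u => ?_)
    simp only
    rw [norm_sub_rev, hsc, norm_sub_rev]
    have := hge u
    gcongr
  have hw'o : inner ℝ (deriv γ s) w' = 0 := by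
    rw [hw', inner_smul_right, hγ.mem_normalSpace_iff.1 hns, mul_zero]
  have hopp := hγ.eq_neg_of_touching hρ hδ
    (fun τ v hv hle z hz hz1 => ?_) hnot hw hw1 hw'o hw'1 hc hc' hne
  · have hst : γ s - γ t = (2 * ρ) • w := by
      have h1 : γ s + ρ • w' = γ t + ρ • w := by rw [← hc, ← hc']
      rw [hopp, smul_neg, ← sub_eq_add_neg, sub_eq_iff_eq_add] at h1
      rw [h1, two_mul, add_smul]; abel
    refine ⟨γ t, γ s, ⟨mem_range_self _, mem_range_self _, hne.symm, ?_, ?_⟩, ?_⟩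
    · rw [hγ.mem_normalSpace_iff, hst, inner_smul_right, hw, mul_zero]
    · rw [hγ.mem_normalSpace_iff, hst, ← neg_neg w, ← hopp, inner_smul_right, inner_neg_right,
        hw'o, neg_zero, mul_zero]
    · rw [dist_comm, dist_eq_norm, hst, norm_smul, hw1, Real.norm_of_nonneg (by positivity)]
      linarith
  -- Separation at radius `r` implies it at `ρ ≤ r`; a negative inner product is harmless.
  · have h1 := hsep τ v hv hle z hz hz1
    rcases le_or_gt 0 (inner ℝ (γ v - γ τ) z) with h3 | h3
    · exact lt_of_le_of_lt (by gcongr) h1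
    · have := sq_nonneg ‖γ v - γ τ‖
      nlinarith

theorem min_le_ballRadius [FiniteDimensional ℝ E] (hγ : IsSimpleClosedC11Curve γ L) :
    min (supCurvature γ)⁻¹ (minDoubleCriticalDist (range γ) / 2) ≤ ballRadius (range γ) := by
  refine hγ.le_ballRadius fun r hr hmeet => ?_
  rw [min_le_iff]
  by_contra! hcon
  obtain ⟨h1, h2⟩ := hcon
  have h3 : supCurvature γ < (ENNReal.ofReal r)⁻¹ := by rwa [ENNReal.lt_inv_iff_lt_inv]
  have htop : supCurvature γ ≠ ⊤ := h3.ne_top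
  have hrk : r * (supCurvature γ).toReal < 1 := by
    rw [← ENNReal.ofReal_inv_of_pos hr, ← ENNReal.toReal_lt_toReal htop (by simp),
      ENNReal.toReal_ofReal (by positivity)] at h3
    have := mul_lt_mul_of_pos_left h3 hr
    rwa [mul_inv_cancel₀ hr.ne'] at this
  have hk : ∀ t, DifferentiableAt ℝ (deriv γ) t → curvature γ t ≤ (supCurvature γ).toReal := by
    intro t ht
    rw [← ENNReal.ofReal_le_iff_le_toReal htop]
    exact le_iSup₂_of_le t ht le_rfl
  obtain ⟨δ, hδ, hsep⟩ := hγ.exists_forall_lt_norm_sub_sq ENNReal.toReal_nonneg hr.le hrk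
    (hγ.norm_unitTangent_sub_le hk)
  obtain ⟨p, q, hpq, hd⟩ := hγ.exists_isDoubleCriticalPair hr hδ hsep hmeet
  have h4 : minDoubleCriticalDist (range γ) ≤ edist p q := sInf_le ⟨p, q, hpq, rfl⟩
  rw [edist_dist] at h4
  have h5 : minDoubleCriticalDist (range γ) / 2 ≤ ENNReal.ofReal r := by
    rw [ENNReal.div_le_iff_le_mul (by simp) (by simp), ← ENNReal.ofReal_ofNat 2,
      ← ENNReal.ofReal_mul hr.le]
    exact h4.trans (ENNReal.ofReal_le_ofReal (by linarith))
  exact h2.not_ge h5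

end IsSimpleClosedC11Curve

end Thickness

end

theorem mainTheorem3 (n : ℕ) (γ : ℝ → EuclideanSpace ℝ (Fin n)) (L : ℝ)
    (hγ : Thickness.IsSimpleClosedC11Curve γ L) (K : Set (EuclideanSpace ℝ (Fin n)))
    (hK : K = Set.range γ) :
    Thickness.normalInjectivityRadius K = Thickness.ballRadius K ∧
      Thickness.ballRadius K =
        min (Thickness.supCurvature γ)⁻¹ (Thickness.minDoubleCriticalDist K / 2) := by
  subst hK
  exact ⟨hγ.normalInjectivityRadius_eq_ballRadius, le_antisymm
    (le_min hγ.ballRadius_le_inv_supCurvature hγ.ballRadius_le_minDoubleCriticalDist_half)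
    hγ.min_le_ballRadius⟩
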